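/- For graphs $T$ and $H$, let $ex(n,T,H)$ denote the maximum number of copies of $T$ (that is, of not necessarily induced subgraphs isomorphic to $T$, counted without labels) in a simple graph on $n$ vertices that contains no copy of $H$; if every graph on $n$ vertices contains $H$, then $ex(n,T,H)=0$. Let $K_t$ be the complete graph on $t$ vertices and let $\chi(H)$ be the chromatic number of $H$. Let $H$ be a fixed finite simple graph and $t\ge 1$ a fixed integer. Then, as $n\to\infty$, $ex(n,K_t,H)=\Omega(n^t)$ (that is, there are $c>0$ and $n_0$ with $ex(n,K_t,H)\ge c\,n^t$ for all $n\ge n_0$) if and only if $\chi(H)>t$. Moreover, if $\chi(H)=k>t$, then $$ex(n,K_t,H)=(1+o(1))\binom{k-1}{t}\left(\frac{n}{k-1}\right)^t.$$ -/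

import Mathlib

open scoped Classical in
/-- The maximum possible number of copies of `T` in an `H`-free graph on `n` vertices, where a copy
of `T` in `G` is a (not necessarily induced, unlabelled) subgraph of `G` isomorphic to `T`.
If there is no `H`-free graph on `n` vertices, this is `0`. -/
noncomputable def generalizedExtremalNumber (n : ℕ) {U W : Type*}
    (T : SimpleGraph U) (H : SimpleGraph W) : ℕ :=
  Finset.sup {G : SimpleGraph (Fin n) | H.Free G} (fun G => G.copyCount T)

/-! Cliques are counted as ordered tuples, `t!` for each copy of `K_t`. Write `χ(H) = r + 1`.

Lower bound: the Turán graph with `r` parts is `r`-colourable, hence `H`-free, and has about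
`r.descFactorial t * (n / r) ^ t` clique tuples.

Upper bound: a positive density of `(r + 1)`-cliques would contain, by Erdős's box theorem
(`exists_injective_box_of_dense`), a large complete `(r + 1)`-partite subgraph, and `H` embeds in
it. So `(r + 1)`-cliques have density `o(1)` in `H`-free graphs. The Moon–Moser inequality relates
three consecutive clique densities. Descending from size `r + 1`, it bounds each ratio `p (j + 1) /
p j` by `1 - j / r` up to a small error, and the product of these ratios is the Turán density
(`IsCliqueProfile.exists_forall_le`).

If `χ(H) ≤ t`, the same upper bound with `r = t - 1` has leading term zero, so the count is `o(n ^
t)`. -/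

namespace SimpleGraph

/-! ### Ordered cliques and the Moon–Moser inequality -/

open Finset

variable {V : Type*} [Fintype V]

open scoped Classical in
/-- The ordered `t`-tuples of pairwise adjacent vertices of `G`. -/
noncomputable def cliqueTuples (G : SimpleGraph V) (t : ℕ) : Finset (Fin t → V) :=
  {f | ∀ i j, i ≠ j → G.Adj (f i) (f j)}

open scoped Classical in
/-- The common neighbours of the entries of a tuple. -/
noncomputable def commonNeighborFinset (G : SimpleGraph V) {t : ℕ} (f : Fin t → V) : Finset V :=
  {v | ∀ j, G.Adj v (f j)}

lemma mem_cliqueTuples {G : SimpleGraph V} {t : ℕ} {f : Fin t → V} :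
    f ∈ G.cliqueTuples t ↔ ∀ i j, i ≠ j → G.Adj (f i) (f j) := by
  simp [cliqueTuples]

lemma mem_commonNeighborFinset {G : SimpleGraph V} {t : ℕ} {f : Fin t → V} {v : V} :
    v ∈ G.commonNeighborFinset f ↔ ∀ j, G.Adj v (f j) := by
  simp [commonNeighborFinset]

lemma card_cliqueTuples_zero (G : SimpleGraph V) : #(G.cliqueTuples 0) = 1 := by
  rw [card_eq_one]
  exact ⟨Fin.elim0, by ext f; simp [mem_cliqueTuples, Subsingleton.elim f Fin.elim0]⟩

lemma card_cliqueTuples_le (G : SimpleGraph V) (t : ℕ) :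
    #(G.cliqueTuples t) ≤ Fintype.card V ^ t := by
  simpa using card_le_univ (G.cliqueTuples t)

lemma insertNth_mem_cliqueTuples_iff {G : SimpleGraph V} {s : ℕ} {i : Fin (s + 1)} {v : V}
    {g : Fin s → V} :
    (Fin.insertNth i v g : Fin (s + 1) → V) ∈ G.cliqueTuples (s + 1) ↔
      g ∈ G.cliqueTuples s ∧ v ∈ G.commonNeighborFinset g := by
  simp only [mem_cliqueTuples, mem_commonNeighborFinset]
  constructor
  · intro h
    refine ⟨fun a b hab ↦ ?_, fun j ↦ ?_⟩
    · simpa using h (i.succAbove a) (i.succAbove b) (by simpa using hab)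
    · simpa using h i (i.succAbove j) (Fin.ne_succAbove i j)
  · rintro ⟨hg, hv⟩ a b hab
    rcases Fin.eq_self_or_eq_succAbove i a with ha | ⟨a, rfl⟩ <;>
      rcases Fin.eq_self_or_eq_succAbove i b with hb | ⟨b, rfl⟩
    · exact absurd (ha.trans hb.symm) hab
    · simpa [ha] using hv b
    · simpa [hb] using (hv a).symm
    · simpa using hg a b (by simpa using hab)

/-- Deleting entry `i` leaves a shorter clique tuple `g`, and the deleted vertex can be any common
neighbour of `g`. The position is arbitrary because Moon–Moser sums over all deletions. -/
lemma sum_cliqueTuples_succ (G : SimpleGraph V) {s : ℕ} (i : Fin (s + 1))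
    (F : (Fin s → V) → ℕ) :
    ∑ f ∈ G.cliqueTuples (s + 1), F (i.removeNth f) =
      ∑ g ∈ G.cliqueTuples s, #(G.commonNeighborFinset g) * F g := by
  calc
    _ = ∑ p ∈ (G.cliqueTuples s).sigma fun g ↦ G.commonNeighborFinset g, F p.1 := by
      symm
      refine sum_bij' (fun p _ ↦ (Fin.insertNth i p.2 p.1 : Fin (s + 1) → V))
        (fun f _ ↦ ⟨i.removeNth f, f i⟩) ?_ ?_ ?_ ?_ ?_
      · rintro ⟨g, v⟩ h
        exact insertNth_mem_cliqueTuples_iff.2 (by simpa using h)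
      · intro f hf
        rw [mem_sigma]
        exact insertNth_mem_cliqueTuples_iff (i := i).1 (by simpa using hf)
      · rintro ⟨g, v⟩ _
        simp
      · intro f _
        simp
      · rintro ⟨g, v⟩ _
        simp
    _ = _ := by simp [sum_sigma]

lemma card_cliqueTuples_succ (G : SimpleGraph V) (s : ℕ) :
    #(G.cliqueTuples (s + 1)) = ∑ g ∈ G.cliqueTuples s, #(G.commonNeighborFinset g) := by
  simpa using G.sum_cliqueTuples_succ (0 : Fin (s + 1)) (fun _ ↦ 1)

lemma card_cliqueTuples_succ_le (G : SimpleGraph V) (s : ℕ) :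
    #(G.cliqueTuples (s + 1)) ≤ #(G.cliqueTuples s) * Fintype.card V := by
  rw [card_cliqueTuples_succ, ← smul_eq_mul]
  exact sum_le_card_nsmul _ _ _ fun g _ ↦ card_le_univ _

/-- A vertex adjacent to all but one entry of a tuple is adjacent to the others as well, or misses
exactly that entry. -/
lemma sum_card_commonNeighborFinset_removeNth_le (G : SimpleGraph V) {s : ℕ}
    (f : Fin (s + 1) → V) :
    ∑ i : Fin (s + 1), #(G.commonNeighborFinset (i.removeNth f)) ≤
      Fintype.card V + s * #(G.commonNeighborFinset f) := by
  classical
  calc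
    _ = ∑ v, ∑ i : Fin (s + 1), if v ∈ G.commonNeighborFinset (i.removeNth f) then 1 else 0 := by
      rw [sum_comm]
      simp
    _ ≤ ∑ v : V, (1 + s * if v ∈ G.commonNeighborFinset f then 1 else 0) := by
      refine sum_le_sum fun v _ ↦ ?_
      by_cases hv : v ∈ G.commonNeighborFinset f
      · rw [if_pos hv]
        refine (sum_le_card_nsmul _ _ 1 fun i _ ↦ by split_ifs <;> simp).trans ?_
        simp [add_comm]
      · rw [if_neg hv, mul_zero, add_zero]
        rw [mem_commonNeighborFinset, not_forall] at hv
        obtain ⟨j, hj⟩ := hv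
        rw [sum_eq_single_of_mem j (mem_univ j)]
        · split_ifs <;> simp
        · intro i _ hij
          refine if_neg fun h ↦ hj ?_
          obtain ⟨k, hk⟩ := Fin.exists_succAbove_eq hij.symm
          simpa [Fin.removeNth, hk] using mem_commonNeighborFinset.1 h k
    _ = _ := by simp [sum_add_distrib, mul_comm]

/-- The **Moon–Moser inequality** for ordered cliques. -/
theorem succ_mul_card_cliqueTuples_sq_le (G : SimpleGraph V) (s : ℕ) :
    (s + 1) * #(G.cliqueTuples (s + 1)) ^ 2 ≤
      s * #(G.cliqueTuples (s + 2)) * #(G.cliqueTuples s) +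
        Fintype.card V * #(G.cliqueTuples (s + 1)) * #(G.cliqueTuples s) := by
  have hcs : #(G.cliqueTuples (s + 1)) ^ 2 ≤
      #(G.cliqueTuples s) * ∑ g ∈ G.cliqueTuples s, #(G.commonNeighborFinset g) ^ 2 := by
    rw [card_cliqueTuples_succ]
    exact sq_sum_le_card_mul_sum_sq
  -- Double counting over pairs of a tuple and a deleted position: grouping by the remaining tuple
  -- `g` turns its codegree into a square.
  have hcount : (s + 1) * ∑ g ∈ G.cliqueTuples s, #(G.commonNeighborFinset g) ^ 2 ≤
      Fintype.card V * #(G.cliqueTuples (s + 1)) + s * #(G.cliqueTuples (s + 2)) := by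
    calc
      _ = ∑ i : Fin (s + 1), ∑ f ∈ G.cliqueTuples (s + 1),
          #(G.commonNeighborFinset (i.removeNth f)) := by
        simp [G.sum_cliqueTuples_succ _ fun g ↦ #(G.commonNeighborFinset g), sq]
      _ = ∑ f ∈ G.cliqueTuples (s + 1), ∑ i : Fin (s + 1),
          #(G.commonNeighborFinset (i.removeNth f)) := sum_comm
      _ ≤ ∑ f ∈ G.cliqueTuples (s + 1),
          (Fintype.card V + s * #(G.commonNeighborFinset f)) :=
        sum_le_sum fun f _ ↦ G.sum_card_commonNeighborFinset_removeNth_le f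
      _ = _ := by
        rw [sum_add_distrib, ← mul_sum, ← card_cliqueTuples_succ]
        simp [mul_comm]
  calc
    _ ≤ (s + 1) * (#(G.cliqueTuples s) *
        ∑ g ∈ G.cliqueTuples s, #(G.commonNeighborFinset g) ^ 2) := Nat.mul_le_mul_left _ hcs
    _ = #(G.cliqueTuples s) * ((s + 1) *
        ∑ g ∈ G.cliqueTuples s, #(G.commonNeighborFinset g) ^ 2) := by ring
    _ ≤ _ := Nat.mul_le_mul_left _ hcount
    _ = _ := by ring

end SimpleGraph

/-! ### Boxes in dense sets of tuples -/

section

open Finset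

/-- Few `(s + 1)`-tuples are not injective. -/
lemma card_filter_not_injective_le {V : Type*} [Fintype V] [DecidableEq V] (s : ℕ) :
    #{z : Fin (s + 1) → V | ¬ Function.Injective z} ≤
      (s + 1) * (s + 1) * Fintype.card V ^ s := by
  have hsub : ({z : Fin (s + 1) → V | ¬ Function.Injective z} : Finset (Fin (s + 1) → V)) ⊆
      (univ : Finset (Fin (s + 1) × Fin (s + 1))).biUnion
        fun p ↦ {z | p.1 ≠ p.2 ∧ z p.1 = z p.2} := by
    intro z hz
    simp only [Function.Injective, mem_filter, mem_univ, true_and, not_forall] at hz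
    obtain ⟨i, j, hij, hne⟩ := hz
    simp only [mem_biUnion, mem_univ, mem_filter, true_and]
    exact ⟨(i, j), hne, hij⟩
  refine (card_le_card hsub).trans (card_biUnion_le.trans ?_)
  refine (sum_le_card_nsmul _ _ (Fintype.card V ^ s) ?_).trans (by simp)
  rintro ⟨i, j⟩ -
  calc
    _ ≤ #(univ : Finset (Fin s → V)) := by
      refine card_le_card_of_injOn (fun z ↦ i.removeNth z) (by simp) ?_
      intro z hz w hw h
      simp only [coe_filter, mem_univ, true_and, Set.mem_ofPred_eq] at hz hw
      obtain ⟨k, hk⟩ := Fin.exists_succAbove_eq hz.1.symm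
      have hj : z j = w j := by rw [← hk]; exact congrFun h k
      ext l
      rcases Fin.eq_self_or_eq_succAbove i l with rfl | ⟨l, rfl⟩
      · rw [hz.2, hw.2, hj]
      · exact congrFun h l
    _ = _ := by simp

/-- Counting tuples of heads that share a tail, by convexity. -/
lemma le_sum_card_filter_forall_cons_mem {V : Type*} [Fintype V] [DecidableEq V] {R s : ℕ}
    (E : Finset (Fin (R + 1) → V)) {c : ℝ} (hc : 0 ≤ c) (hV : 0 < Fintype.card V)
    (hE : c * (Fintype.card V : ℝ) ^ (R + 1) ≤ #E) :
    c ^ (s + 1) * (Fintype.card V : ℝ) ^ (R + (s + 1)) ≤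
      ∑ z : Fin (s + 1) → V,
        (#{y : Fin R → V | ∀ j, (Fin.cons (z j) y : Fin (R + 1) → V) ∈ E} : ℝ) := by
  have hn : 0 < (Fintype.card V : ℝ) := by exact_mod_cast hV
  let d : (Fin R → V) → Finset V := fun y ↦ {v | (Fin.cons v y : Fin (R + 1) → V) ∈ E}
  have hd : (#E : ℝ) = ∑ y, (#(d y) : ℝ) := by
    norm_cast
    calc
      #E = ∑ p : V × (Fin R → V), if (Fin.cons p.1 p.2 : Fin (R + 1) → V) ∈ E then 1 else 0 := by
        exact (card_eq_sum_ones E).trans ((by simp : _ = ∑ f, if f ∈ E then 1 else 0).trans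
          (Equiv.sum_comp (Fin.consEquiv fun _ ↦ V) (fun f ↦ if f ∈ E then 1 else 0)).symm)
      _ = _ := by
        rw [Fintype.sum_prod_type_right]
        simp [d]
  have hswap : ∑ z : Fin (s + 1) → V,
        (#{y : Fin R → V | ∀ j, (Fin.cons (z j) y : Fin (R + 1) → V) ∈ E} : ℝ) =
      ∑ y, (#(d y) : ℝ) ^ (s + 1) := by
    norm_cast
    calc
      _ = ∑ z : Fin (s + 1) → V, ∑ y : Fin R → V,
          if ∀ j, (Fin.cons (z j) y : Fin (R + 1) → V) ∈ E then 1 else 0 := by simp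
      _ = ∑ y : Fin R → V, #{z : Fin (s + 1) → V | ∀ j, z j ∈ d y} := by
        rw [sum_comm]
        simp [d]
      _ = ∑ y : Fin R → V, #(Fintype.piFinset fun _ : Fin (s + 1) ↦ d y) := by
        refine sum_congr rfl fun y _ ↦ congrArg card ?_
        ext z
        simp
      _ = _ := by simp
  rw [hswap]
  have hmean := pow_sum_div_card_le_sum_pow (s := (univ : Finset (Fin R → V)))
    (f := fun y ↦ (#(d y) : ℝ)) (fun _ _ ↦ by positivity) s
  refine le_trans ?_ hmean
  rw [← hd, le_div_iff₀ (by simp; positivity)]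
  calc
    _ = (c * (Fintype.card V : ℝ) ^ (R + 1)) ^ (s + 1) := by
      simp only [card_univ, Fintype.card_fun, Fintype.card_fin, Nat.cast_pow]
      ring
    _ ≤ _ := pow_le_pow_left₀ (by positivity) hE _

/-- **Erdős's theorem** on complete multipartite hypergraphs: a dense set of `R`-tuples contains
a product of large sets. -/
theorem exists_injective_box_of_dense (R s : ℕ) : ∀ c : ℝ, 0 < c → ∃ N : ℕ,
    ∀ {V : Type*} [Fintype V], N ≤ Fintype.card V → ∀ E : Finset (Fin R → V),
      c * (Fintype.card V : ℝ) ^ R ≤ #E →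
        ∃ x : Fin R → Fin (s + 1) → V, (∀ i, Function.Injective (x i)) ∧
          ∀ a : Fin R → Fin (s + 1), (fun i ↦ x i (a i)) ∈ E := by
  induction R with
  | zero =>
    intro c hc
    refine ⟨0, fun {V} _ _ E hE ↦ ?_⟩
    have hpos : 0 < #E := by
      have : (0 : ℝ) < #E := lt_of_lt_of_le (by simpa using hc) hE
      exact_mod_cast this
    obtain ⟨e, he⟩ := card_pos.1 hpos
    exact ⟨Fin.elim0, fun i ↦ i.elim0, fun a ↦ by convert he⟩
  | succ R ih =>
    intro c hc
    -- Convexity gives average density `c ^ (s + 1)` of common tails over all `z`. Half of it pays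
    -- for the non-injective `z`, negligible once `n > M`; the induction hypothesis is applied to
    -- the common tails of one injective `z`.
    obtain ⟨N, hN⟩ := ih (c ^ (s + 1) / 2) (by positivity)
    obtain ⟨M, hM⟩ := exists_nat_gt ((s + 1) * (s + 1) / (c ^ (s + 1) / 2))
    refine ⟨max (max N M) 1, fun {V} _ hV E hE ↦ ?_⟩
    classical
    have hVpos : 0 < Fintype.card V := (le_max_right _ _).trans hV
    have hn : 0 < (Fintype.card V : ℝ) := by exact_mod_cast hVpos
    have hMn : ((s : ℝ) + 1) * (s + 1) < c ^ (s + 1) / 2 * (Fintype.card V : ℝ) := by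
      rw [div_lt_iff₀' (by positivity)] at hM
      refine hM.trans_le (mul_le_mul_of_nonneg_left ?_ (by positivity))
      exact_mod_cast ((le_max_right _ _).trans (le_max_left _ _)).trans hV
    let F : (Fin (s + 1) → V) → Finset (Fin R → V) := fun z ↦
      {y | ∀ j, (Fin.cons (z j) y : Fin (R + 1) → V) ∈ E}
    have hsum : c ^ (s + 1) * (Fintype.card V : ℝ) ^ (R + (s + 1)) ≤ ∑ z, (#(F z) : ℝ) :=
      le_sum_card_filter_forall_cons_mem E hc.le hVpos hE
    obtain ⟨z, hz, hzF⟩ : ∃ z, Function.Injective z ∧ c ^ (s + 1) / 2 * (Fintype.card V : ℝ) ^ R ≤ #(F z) := by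
      by_contra! hcon
      refine absurd hsum (not_le.2 ?_)
      calc
        _ = ∑ z with Function.Injective z, (#(F z) : ℝ) +
            ∑ z with ¬ Function.Injective z, (#(F z) : ℝ) :=
          (sum_filter_add_sum_filter_not _ _ _).symm
        _ ≤ (Fintype.card V : ℝ) ^ (s + 1) * (c ^ (s + 1) / 2 * (Fintype.card V : ℝ) ^ R) +
            ((s + 1) * (s + 1) * (Fintype.card V : ℝ) ^ s) * (Fintype.card V : ℝ) ^ R := by
          refine add_le_add ?_ ?_
          · refine (sum_le_card_nsmul _ _ (c ^ (s + 1) / 2 * (Fintype.card V : ℝ) ^ R) fun z hz ↦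
              (hcon z (mem_filter.1 hz).2).le).trans ?_
            rw [nsmul_eq_mul]
            refine mul_le_mul_of_nonneg_right ?_ (by positivity)
            have := card_le_univ ({z | Function.Injective z} : Finset (Fin (s + 1) → V))
            simp only [Fintype.card_fun, Fintype.card_fin] at this
            exact_mod_cast this
          · refine (sum_le_card_nsmul _ _ ((Fintype.card V : ℝ) ^ R) fun z hz ↦ ?_).trans ?_
            · have := card_le_univ (F z)
              simp only [Fintype.card_fun, Fintype.card_fin] at this
              exact_mod_cast this
            · rw [nsmul_eq_mul]
              refine mul_le_mul_of_nonneg_right ?_ (by positivity)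
              exact_mod_cast card_filter_not_injective_le (V := V) s
        _ < (Fintype.card V : ℝ) ^ (s + 1) * (c ^ (s + 1) / 2 * (Fintype.card V : ℝ) ^ R) +
            (c ^ (s + 1) / 2 * (Fintype.card V : ℝ) * (Fintype.card V : ℝ) ^ s) * (Fintype.card V : ℝ) ^ R := by gcongr
        _ = _ := by ring
    obtain ⟨x, hx, hxE⟩ := hN (((le_max_left _ _).trans (le_max_left _ _)).trans hV) (F z) hzF
    refine ⟨Fin.cons z x, fun i ↦ ?_, fun a ↦ ?_⟩
    · cases i using Fin.cases with
      | zero => simpa using hz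
      | succ i => simpa using hx i
    · have := (mem_filter.1 (hxE (Fin.tail a))).2 (a 0)
      convert this using 1
      ext i
      cases i using Fin.cases <;> simp [Fin.tail]

end

/-! ### Unlabelled copies versus ordered cliques -/

namespace SimpleGraph
open Finset

lemma Copy.toSubgraph_eq_iff {V W : Type*} {A : SimpleGraph W} {G : SimpleGraph V} (B : G.Subgraph)
    (f : A.Copy G) : f.toSubgraph = B ↔ ∃ e : A ≃g B.coe, ∀ a, (e a : V) = f a := by
  constructor
  · rintro rfl
    exact ⟨f.isoToSubgraph, fun a ↦ rfl⟩
  · rintro ⟨e, he⟩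
    ext a b
    · simp only [Subgraph.map_verts, Subgraph.verts_top, Set.image_univ, Set.mem_range]
      constructor
      · rintro ⟨y, rfl⟩
        exact he y ▸ (e y).2
      · intro ha
        exact ⟨e.symm ⟨a, ha⟩, by simp [← he]⟩
    · simp only [Subgraph.map_adj, Relation.map_apply, Subgraph.top_adj]
      constructor
      · rintro ⟨x, y, hxy, rfl, rfl⟩
        have := (e.map_adj_iff).2 hxy
        simpa [he] using this
      · intro hab
        refine ⟨e.symm ⟨a, B.edge_vert hab⟩, e.symm ⟨b, B.edge_vert hab.symm⟩, ?_, ?_, ?_⟩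
        · rw [Iso.map_adj_iff]; simpa using hab
        · simp [← he]
        · simp [← he]

/-- A clique on `t` vertices is the image of `t!` ordered cliques. -/
theorem copyCount_completeGraph_mul_factorial {V : Type*} [Fintype V] (G : SimpleGraph V) (t : ℕ) :
    G.copyCount (completeGraph (Fin t)) * t.factorial = #(G.cliqueTuples t) := by
  classical
  have hcop (f : (completeGraph (Fin t)).Copy G) : (f : Fin t → V) ∈ G.cliqueTuples t :=
    mem_cliqueTuples.2 fun i j hij ↦ f.toHom.map_adj hij
  have htup : #(G.cliqueTuples t) = #(univ : Finset ((completeGraph (Fin t)).Copy G)) := by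
    symm
    refine card_bij' (fun f _ ↦ (f : Fin t → V)) (fun f hf ↦
      ⟨⟨f, fun {i j} hij ↦ mem_cliqueTuples.1 hf i j hij⟩, fun i j hij ↦ by
        by_contra hne
        exact (mem_cliqueTuples.1 hf i j hne).ne hij⟩) ?_ ?_ ?_ ?_
    · exact fun f _ ↦ hcop f
    · simp
    · intro f _; rfl
    · intro f _; rfl
  rw [htup, copyCount_eq_card_image_copyToSubgraph,
    card_eq_sum_card_image (Copy.toSubgraph (A := completeGraph (Fin t)) (B := G)),
    ← smul_eq_mul, ← sum_const]
  refine sum_congr rfl fun B hB ↦ ?_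
  obtain ⟨f, -, rfl⟩ := mem_image.1 hB
  symm
  calc
    -- Copies with the same image as `f` are exactly `f` precomposed with permutations.
    _ = #(univ : Finset (Equiv.Perm (Fin t))) := by
      refine (card_bij (fun (σ : Equiv.Perm (Fin t)) _ ↦
        f.comp (Iso.toCopy (⟨σ, by simp⟩ : completeGraph (Fin t) ≃g completeGraph (Fin t))))
        ?_ ?_ ?_).symm
      · intro σ _
        simp only [mem_filter, mem_univ, true_and]
        rw [Copy.toSubgraph_eq_iff]
        exact ⟨f.isoToSubgraph.comp ⟨σ, by simp⟩, fun a ↦ rfl⟩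
      · intro σ _ τ _ h
        ext1 i
        exact f.injective (DFunLike.congr_fun h i)
      · intro g hg
        simp only [mem_filter, mem_univ, true_and] at hg
        obtain ⟨e, he⟩ := (Copy.toSubgraph_eq_iff _ _).1 hg
        refine ⟨(e.trans f.isoToSubgraph.symm).toEquiv, mem_univ _, ?_⟩
        ext i
        rw [← he]
        exact congrArg Subtype.val (f.isoToSubgraph.apply_symm_apply (e i))
    _ = _ := by simp [card_univ, Fintype.card_perm]

end SimpleGraph

/-! ### Clique densities of `H`-free graphs -/

namespace SimpleGraph
open Finset

/-- A colourable graph embeds into a complete multipartite system of its colour classes. -/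
lemma IsContained.of_coloring_of_box {V W : Type*} [Fintype V] {G : SimpleGraph V}
    {H : SimpleGraph W} {R s : ℕ} (C : H.Coloring (Fin R)) (e : W ↪ Fin s)
    (x : Fin R → Fin s → V) (hx : ∀ i, Function.Injective (x i))
    (hbox : ∀ a : Fin R → Fin s, (fun i ↦ x i (a i)) ∈ G.cliqueTuples R) : H.IsContained G := by
  classical
  have hadj {u v : W} (huv : C u ≠ C v) : G.Adj (x (C u) (e u)) (x (C v) (e v)) := by
    -- Only coordinates `C u` and `C v` of the box point matter; the others are filled with `e v`.
    have := mem_cliqueTuples.1 (hbox (Function.update (fun _ ↦ e v) (C u) (e u))) _ _ huv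
    simpa [Function.update_of_ne huv.symm] using this
  refine ⟨⟨⟨fun w ↦ x (C w) (e w), fun {u v} h ↦ hadj (C.valid h)⟩, fun u v huv ↦ ?_⟩⟩
  by_cases hC : C u = C v
  · refine e.injective (hx (C u) ?_)
    simpa [hC] using huv
  · exact absurd huv (hadj hC).ne

/-- If `H` is `R`-colourable, then large `H`-free graphs have few cliques on `R` vertices. -/
theorem Free.card_cliqueTuples_lt {W : Type*} [Finite W] {H : SimpleGraph W} {R : ℕ}
    (hH : H.Colorable R) {δ : ℝ} (hδ : 0 < δ) : ∃ N : ℕ, ∀ {V : Type*} [Fintype V]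
      {G : SimpleGraph V}, N ≤ Fintype.card V → H.Free G →
        (#(G.cliqueTuples R) : ℝ) < δ * (Fintype.card V : ℝ) ^ R := by
  have := Fintype.ofFinite W
  obtain ⟨N, hN⟩ := exists_injective_box_of_dense R (Fintype.card W) δ hδ
  refine ⟨N, fun {V} _ {G} hV hG ↦ ?_⟩
  by_contra! hcon
  obtain ⟨x, hx, hbox⟩ := hN hV _ hcon
  obtain ⟨C⟩ := hH
  exact hG (.of_coloring_of_box C
    ((Fintype.equivFin W).toEmbedding.trans (Fin.castSuccEmb)) x hx hbox)

/-- The properties of clique densities of a graph used to bound them by Turán's values. -/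
structure IsCliqueProfile (p : ℕ → ℝ) : Prop where
  zero : p 0 = 1
  nonneg (s : ℕ) : 0 ≤ p s
  succ_le (s : ℕ) : p (s + 1) ≤ p s
  moonMoser (s : ℕ) : (s + 1) * p (s + 1) ^ 2 ≤ s * p (s + 2) * p s + p (s + 1) * p s

namespace IsCliqueProfile

variable {p : ℕ → ℝ}

lemma antitone (hp : IsCliqueProfile p) : Antitone p := antitone_nat_of_succ_le hp.succ_le

lemma le_one (hp : IsCliqueProfile p) (s : ℕ) : p s ≤ 1 := hp.zero ▸ hp.antitone s.zero_le

/-- If cliques on `r + 1` vertices are rare, then consecutive clique densities have ratios at most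
those of the complete `r`-partite graph. -/
lemma exists_forall_succ_le (r k : ℕ) : ∀ j : ℕ, 0 < j → j + k = r → ∀ ε : ℝ, 0 < ε →
    ∃ δ : ℝ, 0 < δ ∧ ∀ p : ℕ → ℝ, IsCliqueProfile p → p (r + 1) ≤ δ →
      p (j + 1) ≤ (1 - j / r) * p j + ε := by
  induction k with
  | zero =>
    rintro j hj rfl ε hε
    refine ⟨ε, hε, fun p _ h ↦ ?_⟩
    have : (j : ℝ) ≠ 0 := by positivity
    simpa [div_self this] using h
  | succ k ih =>
    intro j hj hjr ε hε
    -- The error is squared because `p (j + 1) > a + ε` with `a ≥ 0` makes both factors in `hmul`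
    -- exceed `ε`.
    obtain ⟨δ, hδ, h⟩ := ih (j + 1) j.succ_pos (by omega) (ε ^ 2) (by positivity)
    refine ⟨δ, hδ, fun p hp hpr ↦ ?_⟩
    specialize h p hp hpr
    have hr : (0 : ℝ) < r := by exact_mod_cast (by omega : 0 < r)
    have hjr' : (j : ℝ) / r ≤ 1 := by
      rw [div_le_one hr]
      exact_mod_cast (by omega : j ≤ r)
    set a : ℝ := (1 - j / r) * p j with ha
    have ha0 : 0 ≤ a := mul_nonneg (by linarith) (hp.nonneg j)
    have hmul : p (j + 1) * (p (j + 1) - a) ≤ ε ^ 2 := by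
      have hMM := hp.moonMoser j
      have h1 : j * p (j + 2) * p j ≤
          j * ((1 - ((j + 1 : ℕ) : ℝ) / r) * p (j + 1) + ε ^ 2) * p j := by
        have := hp.nonneg j
        gcongr
      -- Rests on `j * (1 - (j + 1) / r) + 1 = (j + 1) * (1 - j / r)`.
      have h2 : ((j : ℝ) + 1) * (p (j + 1) * (p (j + 1) - a)) ≤ j * ε ^ 2 * p j := by
        have : ((j : ℝ) + 1) * (p (j + 1) * (p (j + 1) - a)) + (j * ε ^ 2 * p j) * (-1) +
            (j * ((1 - ((j + 1 : ℕ) : ℝ) / r) * p (j + 1) + ε ^ 2) * p j + p (j + 1) * p j -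
              (j + 1) * p (j + 1) ^ 2) = 0 := by
          rw [ha]
          push_cast
          ring
        linarith
      have h3 : j * ε ^ 2 * p j ≤ (j + 1) * ε ^ 2 := by
        calc
          _ ≤ j * ε ^ 2 * 1 := by
            have := hp.le_one j
            gcongr
          _ ≤ _ := by nlinarith [sq_nonneg ε]
      exact le_of_mul_le_mul_left (h2.trans h3) (by positivity)
    by_contra! hcon
    nlinarith

/-- If cliques on `r + 1` vertices are rare, then clique densities are at most those of the
complete `r`-partite graph. -/
theorem exists_forall_le (r t : ℕ) : ∀ ε : ℝ, 0 < ε → ∃ δ : ℝ, 0 < δ ∧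
    ∀ p : ℕ → ℝ, IsCliqueProfile p → p (r + 1) ≤ δ →
      p t ≤ (r.descFactorial t : ℝ) / r ^ t + ε := by
  induction t with
  | zero =>
    intro ε hε
    refine ⟨1, one_pos, fun p hp _ ↦ ?_⟩
    simp only [hp.zero, Nat.descFactorial_zero, Nat.cast_one, pow_zero, div_one]
    linarith
  | succ t ih =>
    intro ε hε
    rcases lt_or_ge r (t + 1) with hrt | htr
    · refine ⟨ε, hε, fun p hp h ↦ ?_⟩
      rw [Nat.descFactorial_of_lt hrt]
      simpa using (hp.antitone hrt).trans h
    obtain ⟨δ₁, hδ₁, h₁⟩ := ih (ε / 2) (by positivity)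
    obtain ⟨δ₂, hδ₂, h₂⟩ : ∃ δ : ℝ, 0 < δ ∧ ∀ p : ℕ → ℝ, IsCliqueProfile p → p (r + 1) ≤ δ →
        p (t + 1) ≤ (1 - t / r) * p t + ε / 2 := by
      -- For `t = 0` the ratio bound is just `p 1 ≤ p 0`, so any `δ` works.
      rcases Nat.eq_zero_or_pos t with rfl | ht
      · refine ⟨1, one_pos, fun p hp _ ↦ ?_⟩
        have := hp.succ_le 0
        simp only [Nat.cast_zero, zero_div, sub_zero, one_mul]
        linarith
      · exact exists_forall_succ_le r (r - t) t ht (by omega) _ (by positivity)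
    refine ⟨min δ₁ δ₂, lt_min hδ₁ hδ₂, fun p hp h ↦ ?_⟩
    have hr : (0 : ℝ) < r := by exact_mod_cast (by omega : 0 < r)
    have hq0 : 0 ≤ 1 - (t : ℝ) / r := by
      rw [sub_nonneg, div_le_one hr]
      exact_mod_cast (by omega : t ≤ r)
    have hq1 : 1 - (t : ℝ) / r ≤ 1 := by
      have : 0 ≤ (t : ℝ) / r := by positivity
      linarith
    calc
      _ ≤ (1 - t / r) * p t + ε / 2 := h₂ p hp (h.trans (min_le_right _ _))
      _ ≤ (1 - t / r) * ((r.descFactorial t : ℝ) / r ^ t + ε / 2) + ε / 2 := by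
        have := h₁ p hp (h.trans (min_le_left _ _))
        gcongr
      _ ≤ (1 - t / r) * ((r.descFactorial t : ℝ) / r ^ t) + ε := by nlinarith
      _ = _ := by
        rw [Nat.descFactorial_succ, Nat.cast_mul, Nat.cast_sub (by omega)]
        field_simp
        ring

end IsCliqueProfile

/-- Normalising by powers of `n` makes Moon–Moser homogeneous, so no error terms appear. -/
lemma isCliqueProfile_card_cliqueTuples_div {V : Type*} [Fintype V] [Nonempty V]
    (G : SimpleGraph V) :
    IsCliqueProfile fun s ↦ (#(G.cliqueTuples s) : ℝ) / (Fintype.card V : ℝ) ^ s := by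
  have hn : (0 : ℝ) < Fintype.card V := by exact_mod_cast Fintype.card_pos
  refine ⟨by simp [card_cliqueTuples_zero], fun s ↦ by positivity, fun s ↦ ?_, fun s ↦ ?_⟩
  · rw [div_le_div_iff₀ (by positivity) (by positivity)]
    have : (#(G.cliqueTuples (s + 1)) : ℝ) ≤ #(G.cliqueTuples s) * Fintype.card V := by
      exact_mod_cast G.card_cliqueTuples_succ_le s
    calc
      _ ≤ (#(G.cliqueTuples s) * Fintype.card V : ℝ) * (Fintype.card V : ℝ) ^ s := by gcongr
      _ = _ := by ring
  · have h : ((s : ℝ) + 1) * (#(G.cliqueTuples (s + 1)) : ℝ) ^ 2 ≤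
        s * #(G.cliqueTuples (s + 2)) * #(G.cliqueTuples s) +
          Fintype.card V * #(G.cliqueTuples (s + 1)) * #(G.cliqueTuples s) := by
      exact_mod_cast G.succ_mul_card_cliqueTuples_sq_le s
    have h' := div_le_div_of_nonneg_right h
      (by positivity : (0 : ℝ) ≤ ((Fintype.card V : ℝ) ^ (s + 1)) ^ 2)
    refine (le_of_eq ?_).trans (h'.trans (le_of_eq ?_))
    · field_simp
    · field_simp
      ring

/-- If `H` is `(r + 1)`-colourable, then large `H`-free graphs have asymptotically at most as many
cliques as the balanced complete `r`-partite graph. -/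
theorem Free.card_cliqueTuples_le {W : Type*} [Finite W] {H : SimpleGraph W} {r : ℕ}
    (hH : H.Colorable (r + 1)) (t : ℕ) {ε : ℝ} (hε : 0 < ε) : ∃ N : ℕ, ∀ {V : Type*} [Fintype V]
      {G : SimpleGraph V}, N ≤ Fintype.card V → H.Free G →
        (#(G.cliqueTuples t) : ℝ) ≤
          ((r.descFactorial t : ℝ) / r ^ t + ε) * (Fintype.card V : ℝ) ^ t := by
  obtain ⟨δ, hδ, h⟩ := IsCliqueProfile.exists_forall_le r t ε hε
  obtain ⟨N, hN⟩ := Free.card_cliqueTuples_lt hH hδ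
  refine ⟨max N 1, fun {V} _ {G} hV hG ↦ ?_⟩
  have hpos : 0 < Fintype.card V := (le_max_right _ _).trans hV
  have : Nonempty V := Fintype.card_pos_iff.1 hpos
  have hn : (0 : ℝ) < Fintype.card V := by exact_mod_cast hpos
  rw [← div_le_iff₀ (by positivity)]
  refine h _ G.isCliqueProfile_card_cliqueTuples_div ?_
  rw [div_le_iff₀ (by positivity)]
  exact (hN ((le_max_left _ _).trans hV) hG).le

/-- The Turán graph has a clique for each choice of distinct residues and one vertex from each. -/
lemma descFactorial_mul_div_pow_le_card_cliqueTuples_turanGraph {n r t : ℕ} (hr : 0 < r) :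
    r.descFactorial t * (n / r) ^ t ≤ #((turanGraph n r).cliqueTuples t) := by
  classical
  have hlt (i : Fin r) (a : Fin (n / r)) : (i : ℕ) + r * a < n := by
    calc
      _ < r + r * a := by omega
      _ = r * (a + 1) := by ring
      _ ≤ r * (n / r) := Nat.mul_le_mul_left _ a.2
      _ ≤ n := Nat.mul_div_le n r
  have hmod (i : Fin r) (a : Fin (n / r)) : ((i : ℕ) + r * a) % r = i := by
    rw [Nat.add_mul_mod_self_left, Nat.mod_eq_of_lt i.2]
  calc
    _ = #(univ : Finset ((Fin t ↪ Fin r) × (Fin t → Fin (n / r)))) := by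
      simp [Fintype.card_embedding_eq]
    _ ≤ _ := by
      -- The vertex `i + r * a` is number `a` in residue class `i`; its residue recovers `i`.
      refine card_le_card_of_injOn
        (fun p i ↦ (⟨(p.1 i : ℕ) + r * p.2 i, hlt _ _⟩ : Fin n)) ?_ ?_
      · rintro ⟨e, a⟩ -
        simp only [mem_coe, mem_cliqueTuples, turanGraph_adj, hmod]
        exact fun i j hij h ↦ hij (e.injective (Fin.ext h))
      · rintro ⟨e, a⟩ - ⟨e', a'⟩ - h
        have hval (i : Fin t) : (e i : ℕ) + r * a i = e' i + r * a' i :=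
          congrArg Fin.val (congrFun h i)
        have he (i : Fin t) : e i = e' i := by
          have := congrArg (· % r) (hval i)
          simp only [hmod] at this
          exact Fin.ext this
        refine Prod.ext (DFunLike.ext _ _ he) (funext fun i ↦ Fin.ext ?_)
        have := hval i
        rw [he i] at this
        exact Nat.eq_of_mul_eq_mul_left hr (Nat.add_left_cancel this)

lemma turanGraph_colorable {n r : ℕ} (hr : 0 < r) : (turanGraph n r).Colorable r :=
  ⟨Coloring.mk (fun v ↦ (⟨v % r, Nat.mod_lt _ hr⟩ : Fin r)) fun {_ _} h h' ↦
    h (congrArg Fin.val h')⟩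

end SimpleGraph

/-! ### Asymptotics of the extremal number -/

section

open Finset Filter Topology Asymptotics SimpleGraph

variable {W : Type*} {H : SimpleGraph W}

lemma generalizedExtremalNumber_mul_factorial_le {n t : ℕ} {B : ℝ} (hB : 0 ≤ B)
    (h : ∀ G : SimpleGraph (Fin n), H.Free G → (#(G.cliqueTuples t) : ℝ) ≤ B) :
    (generalizedExtremalNumber n (completeGraph (Fin t)) H : ℝ) * t.factorial ≤ B := by
  classical
  have ht : (0 : ℝ) < t.factorial := by exact_mod_cast t.factorial_pos
  -- Taking the floor puts the bound in `ℕ`, where the supremum is formed.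
  rw [← le_div_iff₀ ht, ← Nat.le_floor_iff (by positivity), generalizedExtremalNumber]
  refine Finset.sup_le fun G hG ↦ ?_
  rw [Nat.le_floor_iff (by positivity), le_div_iff₀ ht]
  have hle := h G (mem_filter.1 hG).2
  rw [← copyCount_completeGraph_mul_factorial] at hle
  exact_mod_cast hle

lemma card_cliqueTuples_le_generalizedExtremalNumber {n : ℕ} (t : ℕ) {G : SimpleGraph (Fin n)}
    (hG : H.Free G) : #(G.cliqueTuples t) ≤
      generalizedExtremalNumber n (completeGraph (Fin t)) H * t.factorial := by
  classical
  rw [← copyCount_completeGraph_mul_factorial, generalizedExtremalNumber]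
  refine Nat.mul_le_mul_right _ ?_
  exact le_sup (f := fun G : SimpleGraph (Fin n) ↦ G.copyCount (completeGraph (Fin t)))
    (by simpa using hG)

theorem eventually_generalizedExtremalNumber_le [Finite W] {r : ℕ} (hH : H.Colorable (r + 1))
    (t : ℕ) {ε : ℝ} (hε : 0 < ε) : ∀ᶠ n : ℕ in atTop,
      (generalizedExtremalNumber n (completeGraph (Fin t)) H : ℝ) * t.factorial ≤
        ((r.descFactorial t : ℝ) / r ^ t + ε) * (n : ℝ) ^ t := by
  obtain ⟨N, hN⟩ := Free.card_cliqueTuples_le hH t hε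
  filter_upwards [eventually_ge_atTop N] with n hn
  refine generalizedExtremalNumber_mul_factorial_le (by positivity) fun G hG ↦ ?_
  simpa using hN (G := G) (by simpa using hn) hG

theorem le_generalizedExtremalNumber {r : ℕ} (hr : 0 < r) (hH : ¬ H.Colorable r) (n t : ℕ) :
    r.descFactorial t * (n / r) ^ t ≤
      generalizedExtremalNumber n (completeGraph (Fin t)) H * t.factorial :=
  (descFactorial_mul_div_pow_le_card_cliqueTuples_turanGraph hr).trans
    (card_cliqueTuples_le_generalizedExtremalNumber t fun ⟨f⟩ ↦
      hH ((turanGraph_colorable hr).of_hom f.toHom))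

lemma tendsto_nat_div_div_atTop (r : ℕ) :
    Tendsto (fun n : ℕ ↦ ((n / r : ℕ) : ℝ) / n) atTop (𝓝 (1 / r)) := by
  have := (tendsto_nat_floor_mul_div_atTop (R := ℝ) (a := 1 / r) (by positivity)).comp
    tendsto_natCast_atTop_atTop
  refine this.congr fun n ↦ ?_
  simp only [Function.comp_apply]
  rw [one_div_mul_eq_div, Nat.floor_div_eq_div]

theorem tendsto_generalizedExtremalNumber [Finite W] {r : ℕ} (hr : 0 < r)
    (hH : H.Colorable (r + 1)) (hH' : ¬ H.Colorable r) (t : ℕ) :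
    Tendsto (fun n : ℕ ↦ (generalizedExtremalNumber n (completeGraph (Fin t)) H : ℝ) *
      t.factorial / (n : ℝ) ^ t) atTop (𝓝 ((r.descFactorial t : ℝ) / r ^ t)) := by
  have hlow : Tendsto (fun n : ℕ ↦ (r.descFactorial t : ℝ) * (((n / r : ℕ) : ℝ) / n) ^ t) atTop
      (𝓝 ((r.descFactorial t : ℝ) / r ^ t)) := by
    have := ((tendsto_nat_div_div_atTop r).pow t).const_mul (r.descFactorial t : ℝ)
    simpa [div_eq_mul_inv] using this
  rw [tendsto_order]
  constructor
  · intro a ha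
    filter_upwards [hlow.eventually_const_lt ha] with n hn
    refine hn.trans_le ?_
    rw [div_pow, mul_div_assoc']
    refine div_le_div_of_nonneg_right ?_ (by positivity)
    exact_mod_cast le_generalizedExtremalNumber hr hH' n t
  · intro b hb
    filter_upwards [eventually_generalizedExtremalNumber_le hH t (half_pos (sub_pos.2 hb)),
      eventually_gt_atTop 0] with n hn hn0
    have : (0 : ℝ) < n := by exact_mod_cast hn0
    rw [div_lt_iff₀ (by positivity)]
    refine hn.trans_lt (mul_lt_mul_of_pos_right ?_ (by positivity))
    linarith

/-- If `H` is `t`-colourable, then the extremal number of `K_t` is of smaller order than `n ^ t`. -/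
theorem generalizedExtremalNumber_isLittleO [Finite W] {t : ℕ} (ht : 0 < t)
    (hH : H.Colorable t) :
    (fun n : ℕ ↦ (generalizedExtremalNumber n (completeGraph (Fin t)) H : ℝ)) =o[atTop]
      fun n : ℕ ↦ (n : ℝ) ^ t := by
  obtain ⟨r, rfl⟩ := Nat.exists_eq_succ_of_ne_zero ht.ne'
  rw [isLittleO_iff]
  intro c hc
  filter_upwards [eventually_generalizedExtremalNumber_le hH (r + 1) hc] with n hn
  rw [Nat.descFactorial_of_lt r.lt_succ_self, Nat.cast_zero, zero_div, zero_add] at hn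
  rw [Real.norm_of_nonneg (by positivity), Real.norm_of_nonneg (by positivity)]
  refine le_trans (le_mul_of_one_le_right (by positivity) ?_) hn
  exact_mod_cast Nat.factorial_pos _

theorem generalizedExtremalNumber_isEquivalent [Finite W] {k t : ℕ}
    (hH : H.chromaticNumber = k) (ht : 1 ≤ t) (htk : t < k) :
    (fun n : ℕ ↦ (generalizedExtremalNumber n (completeGraph (Fin t)) H : ℝ)) ~[atTop]
      fun n : ℕ ↦ ((k - 1).choose t : ℝ) * ((n : ℝ) / ((k : ℝ) - 1)) ^ t := by
  obtain ⟨r, rfl⟩ : ∃ r, k = r + 1 := ⟨k - 1, by omega⟩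
  have hr : 0 < r := by omega
  have hr' : (0 : ℝ) < r := by exact_mod_cast hr
  have hcol : H.Colorable (r + 1) := chromaticNumber_le_iff_colorable.1 hH.le
  have hncol : ¬ H.Colorable r := fun h ↦ by
    have := h.chromaticNumber_le
    rw [hH] at this
    exact absurd (by exact_mod_cast this) (Nat.not_succ_le_self r)
  have hdesc : 0 < (r.descFactorial t : ℝ) := by
    exact_mod_cast Nat.pos_of_ne_zero fun h ↦ by
      rw [Nat.descFactorial_eq_zero_iff_lt] at h
      omega
  have hchoose : ((r.choose t : ℕ) : ℝ) = r.descFactorial t / t.factorial := by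
    rw [Nat.descFactorial_eq_factorial_mul_choose, Nat.cast_mul]
    field_simp
  simp only [Nat.add_sub_cancel, Nat.cast_add, Nat.cast_one, add_sub_cancel_right, hchoose]
  have hpos : ∀ᶠ n : ℕ in atTop, (0 : ℝ) < n := by
    filter_upwards [eventually_gt_atTop 0] with n hn
    exact_mod_cast hn
  rw [isEquivalent_iff_tendsto_one (hpos.mono fun n hn ↦ by positivity)]
  have hlim := (tendsto_generalizedExtremalNumber hr hcol hncol t).div_const
    ((r.descFactorial t : ℝ) / r ^ t)
  rw [div_self (by positivity)] at hlim
  refine hlim.congr' (hpos.mono fun n hn ↦ ?_)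
  simp only [Pi.div_apply, div_pow]
  field_simp

end

theorem mainTheorem7 {W : Type*} [Finite W] (H : SimpleGraph W) (t : ℕ) (ht : 1 ≤ t) :
    (Asymptotics.IsBigO Filter.atTop
        (fun n : ℕ => (n : ℝ) ^ t)
        (fun n : ℕ =>
          (generalizedExtremalNumber n (SimpleGraph.completeGraph (Fin t)) H : ℝ)) ↔
      (t : ℕ∞) < H.chromaticNumber) ∧
    ∀ k : ℕ, H.chromaticNumber = (k : ℕ∞) → t < k →
      Asymptotics.IsEquivalent Filter.atTop
        (fun n : ℕ =>
          (generalizedExtremalNumber n (SimpleGraph.completeGraph (Fin t)) H : ℝ))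
        (fun n : ℕ => ((k - 1).choose t : ℝ) * ((n : ℝ) / ((k : ℝ) - 1)) ^ t) := by
  refine ⟨⟨fun hO ↦ ?_, fun hlt ↦ ?_⟩, fun k hk htk ↦
    generalizedExtremalNumber_isEquivalent hk ht htk⟩
  · by_contra! hle
    have ho := hO.trans_isLittleO (generalizedExtremalNumber_isLittleO ht
      (SimpleGraph.chromaticNumber_le_iff_colorable.1 hle))
    refine Asymptotics.isLittleO_irrefl (Filter.Eventually.frequently ?_) ho
    filter_upwards [Filter.eventually_gt_atTop 0] with n hn
    have : (0 : ℝ) < n := by exact_mod_cast hn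
    positivity
  · have := Fintype.ofFinite W
    obtain ⟨k, hk⟩ := ENat.ne_top_iff_exists.1
      (SimpleGraph.chromaticNumber_ne_top_iff_exists.2 ⟨_, H.colorable_of_fintype⟩)
    rw [← hk, Nat.cast_lt] at hlt
    refine Asymptotics.IsBigO.trans ?_ (generalizedExtremalNumber_isEquivalent hk.symm ht hlt).symm.isBigO
    have hk1 : (0 : ℝ) < (k : ℝ) - 1 := by
      have : (1 : ℝ) < k := by exact_mod_cast ht.trans_lt hlt
      linarith
    have hch : (0 : ℝ) < (k - 1).choose t := by
      exact_mod_cast Nat.choose_pos (by omega)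
    -- The constant inverts the leading coefficient, so equality holds.
    refine Asymptotics.IsBigO.of_bound (((k : ℝ) - 1) ^ t / (k - 1).choose t) (.of_forall fun n ↦ ?_)
    rw [Real.norm_of_nonneg (by positivity), Real.norm_of_nonneg (by positivity)]
    refine le_of_eq ?_
    rw [div_pow]
    field_simp
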